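/- Consider a fully efficient battery ($\eta_c=\eta_d=1$) of capacity $B_{\max}\ge 0$. Time is slotted. The exogenous state is a Markov chain $(X_t)_{t\ge 0}$ on $\Omega=\mathcal D\times\mathcal P\times\mathcal M$, where $\mathcal D\subseteq[0,\infty)$ (demands) and $\mathcal P\subseteq\mathbb R$ (prices) are nonempty compact sets and $\mathcal M$ is a nonempty measurable space of modulating states; $d(x)$ and $p(x)$ denote the demand and the price in state $x$. Let $\bar A_c,\bar A_d\ge 0$ be charging and discharging limits, functions of the battery level on $[0,B_{\max}]$. In state $x$ and at battery level $b\in[0,B_{\max}]$ the next battery level $\beta$ must be chosen in $U_x(b)=[U_x^-(b),U^+(b)]$, where $$U_x^-(b)=\max\{0,\,b-d(x),\,b-\bar A_d(b)\},\qquad U^+(b)=\min\{B_{\max},\,b+\bar A_c(b)\},$$ at the cost $\gamma_x(\beta-b)=(d(x)+\beta-b)\,p(x)$. Assume that for every $x\in\Omega$ the set $\{(b,\beta): b\in[0,B_{\max}],\ \beta\in U_x(b)\}$ is convex and closed (for instance, $\bar A_c$ and $\bar A_d$ are concave and continuous). Let $0<\alpha<1$, let $J_x(b)$ be the infimum, over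 all nonanticipative measurable feasible operations of the battery, of the expected total discounted cost $\mathbb E\sum_{t\ge 0}\alpha^t g(t)$ from initial state $x$ and level $b$, where $g(t)$ is the cost in slot $t$, and let $G_x(\beta)=\mathbb E[J_{X_1}(\beta)\mid X_0=x]$. Let $\partial G_x(\beta)$ be the subdifferential of $G_x$ as a function on $[0,B_{\max}]$. A threshold $\beta_x$ in state $x$ is any element of $[\beta_{1,x},\beta_{2,x}]$, where $$\beta_{1,x}=\min\{\beta\in[0,B_{\max}]:\ p(x)+\alpha g\ge 0\text{ for some }g\in\partial G_x(\beta)\},$$ $$\beta_{2,x}=\max\{\beta\in[0,B_{\max}]:\ p(x)+\alpha g\le 0\text{ for some }g\in\partial G_x(\beta)\},$$ with $\beta_{1,x}=B_{\max}$, respectively $\beta_{2,x}=0$, if the set in question is empty. Assume that prices and demands are i.i.d. across time, i.e. the conditional law of $(d(X_{t+1}),p(X_{t+1}))$ given $X_t=x$ is the same for all $x\in\Omega$. Then: (1) every state has a threshold; (2) the set of thresholds in state $x$ depends on $x$ only through the price $p(x)$; (3) the threshold is non-increasing in the price: if $p\mapsto\beta_p$ is any function on $\mathcal P$ such that $\beta_{p(x)}$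 is a threshold in state $x$ for every $x\in\Omega$, then $\beta_p\ge\beta_q$ whenever $p\le q$. Moreover, these are thresholds of an optimal policy: for every initial state and every initial level in $[0,B_{\max}]$, the stationary policy that in state $x$ moves the level $b$ to $\min\{\beta_{p(x)},U^+(b)\}$ if $b\le\beta_{p(x)}$ and to $\max\{\beta_{p(x)},U_x^-(b)\}$ otherwise minimizes the expected total discounted cost. -/

import Mathlib

open MeasureTheory ProbabilityTheory Set

noncomputable section

/-- Data of the storage problem: a battery of capacity `Bmax` with charging and discharging
efficiencies `ηc`, `ηd` and level-dependent rate limits `Ac`, `Ad`; a discount factor `α`;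
compact sets `D` of demands and `P` of prices; modulating states `M`; and the transition law
`κ` of the exogenous Markov chain on `D × P × M` (not required to have a density). -/
structure StorageModel (M : Type*) [MeasurableSpace M] where
  Bmax : ℝ
  Bmax_nonneg : 0 ≤ Bmax
  ηc : ℝ
  ηc_mem : ηc ∈ Ioc (0 : ℝ) 1
  ηd : ℝ
  ηd_mem : ηd ∈ Ioc (0 : ℝ) 1
  Ac : ℝ → ℝ
  Ac_nonneg : ∀ b ∈ Icc 0 Bmax, 0 ≤ Ac b
  Ad : ℝ → ℝ
  Ad_nonneg : ∀ b ∈ Icc 0 Bmax, 0 ≤ Ad b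
  α : ℝ
  α_mem : α ∈ Ioo (0 : ℝ) 1
  D : Set ℝ
  D_nonempty : D.Nonempty
  D_compact : IsCompact D
  D_nonneg : ∀ r ∈ D, 0 ≤ r
  P : Set ℝ
  P_nonempty : P.Nonempty
  P_compact : IsCompact P
  κ : Kernel (D × P × M) (D × P × M)
  markov : IsMarkovKernel κ

namespace StorageModel

variable {M : Type*} [MeasurableSpace M] (S : StorageModel M)

/-- The exogenous state space: demand, price, modulating state. -/
abbrev State : Type _ := S.D × S.P × M

instance : IsMarkovKernel S.κ := S.markov

/-- Demand in a state. -/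
def demand (x : S.State) : ℝ := (x.1 : ℝ)

/-- Price in a state. -/
def price (x : S.State) : ℝ := (x.2.1 : ℝ)

/-- Immediate cost in state `x` when the battery level changes by `δ`. -/
def stageCost (x : S.State) (δ : ℝ) : ℝ :=
  (S.demand x + S.ηc⁻¹ * max δ 0 - S.ηd * max (-δ) 0) * S.price x

/-- Lowest battery level reachable in one slot: the battery cannot go below zero, deliver more
than the demand, or discharge faster than its rate limit. -/
def lowerEnd (x : S.State) (b : ℝ) : ℝ :=
  max 0 (max (b - S.demand x / S.ηd) (b - S.Ad b))

/-- Highest battery level reachable in one slot. -/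
def upperEnd (b : ℝ) : ℝ := min S.Bmax (b + S.ηc * S.Ac b)

/-- Feasible next battery levels. -/
def control (x : S.State) (b : ℝ) : Set ℝ := Icc (S.lowerEnd x b) (S.upperEnd b)

/-- Law of the whole exogenous trajectory of the chain started in `x`. -/
def pathLaw (x : S.State) : Measure (ℕ → S.State) :=
  Kernel.traj (X := fun _ => S.State)
    (fun n => S.κ.comap (fun h : (i : Finset.Iic n) → S.State => h ⟨n, by simp⟩)
      (measurable_pi_apply _)) 0 (fun _ => x)

/-- A nonanticipative feasible battery operation from level `b`: `B t ω` is the battery level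
at time `t`, and `B (t + 1)` is a function of the exogenous states at times `0, …, t`. -/
structure Admissible (b : ℝ) (B : ℕ → (ℕ → S.State) → ℝ) : Prop where
  init : ∀ ω, B 0 ω = b
  adapted : ∀ t, Measurable[Filtration.piLE (X := fun _ : ℕ => S.State) t] (B (t + 1))
  feasible : ∀ t ω, B (t + 1) ω ∈ S.control (ω t) (B t ω)

/-- Expected total discounted cost of the operation `B` when the chain starts in `x`. -/
def cost (x : S.State) (B : ℕ → (ℕ → S.State) → ℝ) : ℝ :=
  ∫ ω, ∑' t : ℕ, S.α ^ t * S.stageCost (ω t) (B (t + 1) ω - B t ω) ∂(S.pathLaw x)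

/-- `B` solves the cost minimization problem from state `x` and battery level `b`. -/
def IsOptimal (x : S.State) (b : ℝ) (B : ℕ → (ℕ → S.State) → ℝ) : Prop :=
  S.Admissible b B ∧ ∀ B', S.Admissible b B' → S.cost x B ≤ S.cost x B'

/-- Minimal expected total discounted cost `J_x(b)`. -/
def J (x : S.State) (b : ℝ) : ℝ := sInf {c | ∃ B, S.Admissible b B ∧ c = S.cost x B}

/-- Expected minimal future cost `G_x(β)` when the next battery level is `β`. -/
def G (x : S.State) (β : ℝ) : ℝ := ∫ y, S.J y β ∂(S.κ x)

/-- Subdifferential at `β` of `G_x` as a function on `[0, Bmax]`. -/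
def subdiffG (x : S.State) (β : ℝ) : Set ℝ :=
  {g | ∀ β' ∈ Icc 0 S.Bmax, S.G x β + g * (β' - β) ≤ S.G x β'}

/-- Levels at which `c + α g ≥ 0` for some (equivalently, for the largest) subgradient `g`. -/
def setOne (x : S.State) (c : ℝ) : Set ℝ :=
  {β ∈ Icc 0 S.Bmax | ∃ g ∈ S.subdiffG x β, 0 ≤ c + S.α * g}

/-- Levels at which `c + α g ≤ 0` for some (equivalently, for the smallest) subgradient `g`. -/
def setTwo (x : S.State) (c : ℝ) : Set ℝ :=
  {β ∈ Icc 0 S.Bmax | ∃ g ∈ S.subdiffG x β, c + S.α * g ≤ 0}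

open Classical in
/-- Smallest threshold for the marginal price `c`. -/
def endOne (x : S.State) (c : ℝ) : ℝ :=
  if (S.setOne x c).Nonempty then sInf (S.setOne x c) else S.Bmax

open Classical in
/-- Largest threshold for the marginal price `c`. -/
def endTwo (x : S.State) (c : ℝ) : ℝ :=
  if (S.setTwo x c).Nonempty then sSup (S.setTwo x c) else 0

/-- The possible charging thresholds `β⁻` in state `x`. -/
def chargingThresholds (x : S.State) : Set ℝ :=
  Icc (S.endOne x (S.ηc⁻¹ * S.price x)) (S.endTwo x (S.ηc⁻¹ * S.price x))

/-- The possible discharging thresholds `β⁺` in state `x`. -/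
def dischargingThresholds (x : S.State) : Set ℝ :=
  Icc (S.endOne x (S.ηd * S.price x)) (S.endTwo x (S.ηd * S.price x))

/-- `β` is a common charging and discharging threshold in state `x`. -/
def IsThreshold (x : S.State) (β : ℝ) : Prop :=
  β ∈ S.chargingThresholds x ∧ β ∈ S.dischargingThresholds x

open Classical in
/-- Next battery level under the two-threshold rule: charge towards `βlo` when below it,
discharge towards `βhi` when above it, otherwise keep the level. -/
def thresholdAction (x : S.State) (βlo βhi b : ℝ) : ℝ :=
  if b ≤ βlo then min βlo (S.upperEnd b)
  else if βhi ≤ b then max βhi (S.lowerEnd x b)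
  else b

/-- Battery levels from `b` under the stationary policy with thresholds `βlo x`, `βhi x`. -/
def thresholdPath (βlo βhi : S.State → ℝ) (b : ℝ) : ℕ → (ℕ → S.State) → ℝ
  | 0, _ => b
  | t + 1, ω =>
    S.thresholdAction (ω t) (βlo (ω t)) (βhi (ω t)) (thresholdPath βlo βhi b t ω)

/-- Prices and demands are i.i.d. across time: whatever the current state, the next
(demand, price) pair has one and the same law. -/
def IIDDemandPrice : Prop :=
  ∀ x x' : S.State, (S.κ x).map (fun y => (S.demand y, S.price y)) =
    (S.κ x').map (fun y => (S.demand y, S.price y))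

/-- In each state, the set of feasible pairs (current level, next level) is convex and closed;
for instance when `Ac` and `Ad` are concave and continuous on `[0, Bmax]`. -/
def ConvexControl : Prop :=
  ∀ x : S.State,
    Convex ℝ {q : ℝ × ℝ | q.1 ∈ Icc 0 S.Bmax ∧ q.2 ∈ S.control x q.1} ∧
    IsClosed {q : ℝ × ℝ | q.1 ∈ Icc 0 S.Bmax ∧ q.2 ∈ S.control x q.1}

end StorageModel

end

noncomputable section

/-! The proof is dynamic programming. With both efficiencies equal to 1 the stage cost is affine in
the new level, so for a convex future cost `f` the slot's problem is to minimize `p a + α f a` over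
an interval. The minimizer over an interval is the projection onto it of a minimizer over all of
`[0, Bmax]`, and this projection is the threshold rule (`IsTarget.lookahead_le`).

The one-step value depends on the state only through demand and price, so in the i.i.d. case its
expectation does not depend on the current state. The Bellman equation thus becomes an equation for
one function of the level, solved by a contraction on bounded continuous functions convex on `[0,
Bmax]` (`exists_fixedPoint`). Verification along trajectories gives `J_eq_stepValue`, so every `G_x`
equals the fixed point `f` on `[0, Bmax]`.

By `isThreshold_iff` the thresholds are exactly the minimizers of `p β + α f β`. They exist by
compactness, depend only on `p`, and decrease in `p` by an exchange argument. Monotonicity also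
makes any choice of thresholds measurable, so no measurable selection theorem is needed. -/

/-! ### Continuity of convex functions up to the ends of a closed interval. -/

theorem ConvexOn.upperSemicontinuousOn_Icc {f : ℝ → ℝ} {l u : ℝ}
    (hf : ConvexOn ℝ (Icc l u) f) : UpperSemicontinuousOn f (Icc l u) := by
  -- The chord from `c` to `e` dominates `f` and tends to `f c` at `c`, so `f < y` at some point
  -- strictly on the way to `e`. Convexity of the strict sublevel set then gives a one-sided
  -- neighbourhood of `c`; taking `e = u` and `e = l` covers both sides.
  have key : ∀ c ∈ Icc l u, ∀ e ∈ Icc l u, ∀ y, f c < y →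
      ∃ t ∈ Ioc (0 : ℝ) 1, f (c + t * (e - c)) < y := by
    intro c hc e he y hy
    have hcont : Continuous fun t : ℝ => (1 - t) * f c + t * f e := by fun_prop
    have h0 : ∀ᶠ t in nhds (0 : ℝ), (1 - t) * f c + t * f e < y :=
      (hcont.tendsto 0).eventually (Iio_mem_nhds (by simpa using hy))
    obtain ⟨t, ht, ht'⟩ := ((h0.filter_mono nhdsWithin_le_nhds).and
      (Ioc_mem_nhdsGT (zero_lt_one' ℝ))).exists
    refine ⟨t, ht', lt_of_le_of_lt ?_ ht⟩
    have := hf.2 hc he (sub_nonneg.2 ht'.2) ht'.1.le (by ring)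
    simp only [smul_eq_mul] at this
    convert this using 2
    ring
  intro c hc y hy
  have hord := (hf.convex_lt y).ordConnected
  have hu : ∀ᶠ b in nhdsWithin c (Icc l u), b ≤ c ∨ b ∈ Icc l u ∧ f b < y := by
    rcases eq_or_lt_of_le hc.2 with rfl | hcu
    · filter_upwards [self_mem_nhdsWithin] with b hb using Or.inl hb.2
    obtain ⟨t, ht, hty⟩ := key c hc u ⟨hc.1.trans hc.2, le_rfl⟩ y hy
    have hpos : 0 < t * (u - c) := mul_pos ht.1 (sub_pos.2 hcu)
    have hle : t * (u - c) ≤ u - c := mul_le_of_le_one_left (sub_pos.2 hcu).le ht.2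
    filter_upwards [mem_nhdsWithin_of_mem_nhds (Iio_mem_nhds (show c < c + t * (u - c) by linarith))]
      with b hb
    by_cases hbc : b ≤ c
    · exact Or.inl hbc
    · exact Or.inr (hord.out ⟨hc, hy⟩ ⟨⟨by linarith [hc.1], by linarith⟩, hty⟩
        ⟨(not_le.1 hbc).le, le_of_lt hb⟩)
  have hl : ∀ᶠ b in nhdsWithin c (Icc l u), c ≤ b ∨ b ∈ Icc l u ∧ f b < y := by
    rcases eq_or_lt_of_le hc.1 with rfl | hcl
    · filter_upwards [self_mem_nhdsWithin] with b hb using Or.inl hb.1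
    obtain ⟨t, ht, hty⟩ := key c hc l ⟨le_rfl, hc.1.trans hc.2⟩ y hy
    have hpos : 0 < t * (c - l) := mul_pos ht.1 (sub_pos.2 hcl)
    have hle : t * (c - l) ≤ c - l := mul_le_of_le_one_left (sub_pos.2 hcl).le ht.2
    filter_upwards [mem_nhdsWithin_of_mem_nhds (Ioi_mem_nhds (show c + t * (l - c) < c by linarith))]
      with b hb
    by_cases hbc : c ≤ b
    · exact Or.inl hbc
    · exact Or.inr (hord.out ⟨⟨by linarith, by linarith [hc.2]⟩, hty⟩ ⟨hc, hy⟩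
        ⟨le_of_lt hb, (not_le.1 hbc).le⟩)
  filter_upwards [hu, hl] with b h1 h2
  rcases h1 with h1 | h1
  · rcases h2 with h2 | h2
    · rwa [le_antisymm h1 h2]
    · exact h2.2
  · exact h1.2

theorem ConvexOn.continuousOn_Icc_of_isClosed_sublevel {f : ℝ → ℝ} {l u : ℝ}
    (hf : ConvexOn ℝ (Icc l u) f) (hc : ∀ y, IsClosed (Icc l u ∩ f ⁻¹' Iic y)) :
    ContinuousOn f (Icc l u) := by
  refine continuousOn_iff_lower_upperSemicontinuousOn.2 ⟨?_, hf.upperSemicontinuousOn_Icc⟩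
  refine lowerSemicontinuousOn_iff_preimage_Iic.2 fun y => ⟨_, hc y, ?_⟩
  rw [← inter_assoc, inter_self]

/-! ### The control interval and the threshold action: continuity and measurability. -/

namespace StorageModel

variable {M : Type*} [MeasurableSpace M] (S : StorageModel M)

section Control

variable {S}

theorem lowerEnd_le (x : S.State) {b : ℝ} (hb : b ∈ Icc 0 S.Bmax) : S.lowerEnd x b ≤ b := by
  have h1 := S.Ad_nonneg b hb
  have h2 : 0 ≤ S.demand x / S.ηd := div_nonneg (S.D_nonneg _ x.1.2) S.ηd_mem.1.le
  simp only [lowerEnd, max_le_iff]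
  exact ⟨hb.1, by linarith, by linarith⟩

theorem le_upperEnd {b : ℝ} (hb : b ∈ Icc 0 S.Bmax) : b ≤ S.upperEnd b :=
  le_min hb.2 (by linarith [mul_nonneg S.ηc_mem.1.le (S.Ac_nonneg b hb)])

theorem control_subset (x : S.State) (b : ℝ) : S.control x b ⊆ Icc 0 S.Bmax := fun _ ha =>
  ⟨(le_max_left _ _).trans ha.1, ha.2.trans (min_le_left _ _)⟩

theorem lowerEnd_mem_control (x : S.State) {b : ℝ} (hb : b ∈ Icc 0 S.Bmax) :
    S.lowerEnd x b ∈ S.control x b := ⟨le_rfl, (lowerEnd_le x hb).trans (le_upperEnd hb)⟩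

theorem upperEnd_mem_control (x : S.State) {b : ℝ} (hb : b ∈ Icc 0 S.Bmax) :
    S.upperEnd b ∈ S.control x b := ⟨(lowerEnd_le x hb).trans (le_upperEnd hb), le_rfl⟩

theorem ConvexControl.combo_mem (hconv : S.ConvexControl) (x : S.State) {b₁ b₂ a₁ a₂ s t : ℝ}
    (hb₁ : b₁ ∈ Icc 0 S.Bmax) (hb₂ : b₂ ∈ Icc 0 S.Bmax)
    (ha₁ : a₁ ∈ S.control x b₁) (ha₂ : a₂ ∈ S.control x b₂)
    (hs : 0 ≤ s) (ht : 0 ≤ t) (hst : s + t = 1) :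
    s * a₁ + t * a₂ ∈ S.control x (s * b₁ + t * b₂) :=
  ((hconv x).1 (x := (b₁, a₁)) ⟨hb₁, ha₁⟩ (y := (b₂, a₂)) ⟨hb₂, ha₂⟩ hs ht hst).2

theorem ConvexControl.isCompact (hconv : S.ConvexControl) (x : S.State) :
    IsCompact {q : ℝ × ℝ | q.1 ∈ Icc 0 S.Bmax ∧ q.2 ∈ S.control x q.1} :=
  (isCompact_Icc.prod isCompact_Icc).of_isClosed_subset (hconv x).2
    fun q hq => (⟨hq.1, control_subset x _ hq.2⟩ : q ∈ Icc 0 S.Bmax ×ˢ Icc 0 S.Bmax)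

/-- The lower boundary of a convex set is a convex function, and its sublevel sets are projections
of compact sets, hence closed. -/
theorem ConvexControl.continuousOn_lowerEnd (hconv : S.ConvexControl) (x : S.State) :
    ContinuousOn (S.lowerEnd x) (Icc 0 S.Bmax) := by
  refine ConvexOn.continuousOn_Icc_of_isClosed_sublevel ⟨convex_Icc _ _, ?_⟩ fun y => ?_
  · intro b₁ hb₁ b₂ hb₂ s t hs ht hst
    exact (hconv.combo_mem x hb₁ hb₂ (lowerEnd_mem_control x hb₁) (lowerEnd_mem_control x hb₂)
      hs ht hst).1
  · have := (((hconv.isCompact x).inter_right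
      (isClosed_le continuous_snd (continuous_const (y := y)))).image continuous_fst).isClosed
    convert this using 1
    ext b
    constructor
    · rintro ⟨hb, hy⟩
      exact ⟨(b, S.lowerEnd x b), ⟨⟨hb, lowerEnd_mem_control x hb⟩, hy⟩, rfl⟩
    · rintro ⟨q, ⟨⟨hb, hq⟩, hy⟩, rfl⟩
      exact ⟨hb, hq.1.trans hy⟩

theorem ConvexControl.continuousOn_upperEnd (hconv : S.ConvexControl) (x : S.State) :
    ContinuousOn S.upperEnd (Icc 0 S.Bmax) := by
  suffices h : ContinuousOn (fun b => -S.upperEnd b) (Icc 0 S.Bmax) from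
    h.neg.congr fun b _ => (neg_neg _).symm
  refine ConvexOn.continuousOn_Icc_of_isClosed_sublevel ⟨convex_Icc _ _, ?_⟩ fun y => ?_
  · intro b₁ hb₁ b₂ hb₂ s t hs ht hst
    have := (hconv.combo_mem x hb₁ hb₂ (upperEnd_mem_control x hb₁) (upperEnd_mem_control x hb₂)
      hs ht hst).2
    simp only [smul_eq_mul]
    linarith
  · have := (((hconv.isCompact x).inter_right
      (isClosed_le continuous_snd.neg (continuous_const (y := y)))).image continuous_fst).isClosed
    convert this using 1
    ext b
    constructor
    · rintro ⟨hb, hy⟩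
      exact ⟨(b, S.upperEnd b), ⟨⟨hb, upperEnd_mem_control x hb⟩, hy⟩, rfl⟩
    · rintro ⟨q, ⟨⟨hb, hq⟩, hy⟩, rfl⟩
      exact ⟨hb, (neg_le_neg hq.2).trans hy⟩

end Control

/-- Projection of a level onto `[0, Bmax]`. -/
def clip (b : ℝ) : ℝ := projIcc 0 S.Bmax S.Bmax_nonneg b

variable {S}

theorem clip_mem (b : ℝ) : S.clip b ∈ Icc 0 S.Bmax := (projIcc 0 S.Bmax S.Bmax_nonneg b).2

theorem clip_of_mem {b : ℝ} (hb : b ∈ Icc 0 S.Bmax) : S.clip b = b := by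
  rw [clip, projIcc_of_mem _ hb]

theorem continuous_clip : Continuous S.clip := continuous_subtype_val.comp continuous_projIcc

/-- With a single threshold the rule projects `β` onto the control interval. This form makes
continuity in the level and measurability in the state visible. -/
theorem thresholdAction_eq (x : S.State) (β : ℝ) {b : ℝ} (hb : b ∈ Icc 0 S.Bmax) :
    S.thresholdAction x β β b = max (S.lowerEnd x b) (min β (S.upperEnd b)) := by
  have h1 := lowerEnd_le x hb
  have h2 := le_upperEnd hb
  rw [thresholdAction]
  split_ifs with h h'
  · exact (max_eq_right (le_min (h1.trans h) (h1.trans h2))).symm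
  · rw [min_eq_left (h'.trans h2), max_comm]
  · exact absurd (le_of_not_ge h) h'

theorem thresholdAction_mem_control (x : S.State) (β : ℝ) {b : ℝ} (hb : b ∈ Icc 0 S.Bmax) :
    S.thresholdAction x β β b ∈ S.control x b := by
  rw [thresholdAction_eq x β hb]
  exact ⟨le_max_left _ _, max_le ((lowerEnd_le x hb).trans (le_upperEnd hb)) (min_le_right _ _)⟩

theorem ConvexControl.continuous_thresholdAction (hconv : S.ConvexControl) (x : S.State) (β : ℝ) :
    Continuous fun b => S.thresholdAction x β β (S.clip b) := by
  simp only [fun b => thresholdAction_eq x β (clip_mem (S := S) b)]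
  exact ((hconv.continuousOn_lowerEnd x).comp_continuous continuous_clip clip_mem).max
    (continuous_const.min
      ((hconv.continuousOn_upperEnd x).comp_continuous continuous_clip clip_mem))

theorem measurable_demand : Measurable S.demand := measurable_subtype_coe.comp measurable_fst

theorem measurable_price : Measurable S.price :=
  measurable_subtype_coe.comp (measurable_fst.comp measurable_snd)

theorem measurable_thresholdAction {β : S.State → ℝ} (hβ : Measurable β) {b : ℝ}
    (hb : b ∈ Icc 0 S.Bmax) : Measurable fun x => S.thresholdAction x (β x) (β x) b := by
  simp only [fun x => thresholdAction_eq x (β x) hb, lowerEnd]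
  have := measurable_demand (S := S)
  fun_prop

/-- A Carathéodory function, continuous in the level and measurable in the state, is jointly
measurable. Clipping extends it to all real levels. -/
theorem ConvexControl.measurable_thresholdAction_uncurry (hconv : S.ConvexControl)
    {β : S.State → ℝ} (hβ : Measurable β) :
    Measurable fun q : ℝ × S.State =>
      S.thresholdAction q.2 (β q.2) (β q.2) (S.clip q.1) :=
  measurable_uncurry_of_continuous_of_measurable
    (u := fun b x => S.thresholdAction x (β x) (β x) (S.clip b))
    (fun x => hconv.continuous_thresholdAction x (β x))
    fun b => measurable_thresholdAction hβ (clip_mem b)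

/-! ### The one-step problem with a given future cost. -/

/-- `β` minimizes `p β + α f β` over `[0, Bmax]`. -/
def IsTarget (S : StorageModel M) (f : ℝ → ℝ) (p β : ℝ) : Prop :=
  β ∈ Icc 0 S.Bmax ∧ ∀ β' ∈ Icc 0 S.Bmax, p * β + S.α * f β ≤ p * β' + S.α * f β'

theorem exists_isTarget {f : ℝ → ℝ} (hf : ContinuousOn f (Icc 0 S.Bmax)) (p : ℝ) :
    ∃ β, S.IsTarget f p β := by
  obtain ⟨β, hβ, hmin⟩ := isCompact_Icc.exists_isMinOn (nonempty_Icc.2 S.Bmax_nonneg)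
    (f := fun β => p * β + S.α * f β) (by fun_prop)
  exact ⟨β, hβ, fun β' hβ' => hmin hβ'⟩

/-- Adding the two optimality inequalities cancels `f` and leaves `(q - p) * (β' - β) ≤ 0`. No
convexity enters, and the minimizers may be chosen arbitrarily. -/
theorem IsTarget.le_of_lt {f : ℝ → ℝ} {p q β β' : ℝ} (hβ : S.IsTarget f p β)
    (hβ' : S.IsTarget f q β') (hpq : p < q) : β' ≤ β := by
  have h1 := hβ.2 β' hβ'.1
  have h2 := hβ'.2 β hβ.1
  nlinarith

/-- Immediate cost plus discounted future cost `f` when moving from level `b` to level `a`. -/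
def lookahead (S : StorageModel M) (f : ℝ → ℝ) (x : S.State) (b a : ℝ) : ℝ :=
  S.stageCost x (a - b) + S.α * f a

theorem stageCost_eq (hηc : S.ηc = 1) (hηd : S.ηd = 1) (x : S.State) (δ : ℝ) :
    S.stageCost x δ = (S.demand x + δ) * S.price x := by
  rw [stageCost, hηc, hηd]
  rcases le_total 0 δ with h | h
  · rw [max_eq_left h, max_eq_right (by linarith)]; ring
  · rw [max_eq_right h, max_eq_left (by linarith)]; ring

theorem IsTarget.lookahead_le (hηc : S.ηc = 1) (hηd : S.ηd = 1) {f : ℝ → ℝ}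
    (hf : ConvexOn ℝ (Icc 0 S.Bmax) f) {x : S.State} {β : ℝ} (hβ : S.IsTarget f (S.price x) β)
    {b a : ℝ} (hb : b ∈ Icc 0 S.Bmax) (ha : a ∈ S.control x b) :
    S.lookahead f x b (S.thresholdAction x β β b) ≤ S.lookahead f x b a := by
  have hφ : ConvexOn ℝ (Icc 0 S.Bmax) fun a => S.price x * a + S.α * f a :=
    ((LinearMap.mulLeft ℝ (S.price x)).convexOn (convex_Icc _ _)).add (hf.smul S.α_mem.1.le)
  have hmem := thresholdAction_mem_control x β hb
  have hclamp := thresholdAction_eq x β hb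
  set c := S.thresholdAction x β β b
  suffices h : S.price x * c + S.α * f c ≤ S.price x * a + S.α * f a by
    simp only [lookahead, stageCost_eq hηc hηd]; linarith
  -- The projection of `β` onto an interval lies between `β` and any point `a` of that interval, so
  -- a convex function there is at most the larger of its values at `β` and `a`, which is the value
  -- at `a`.
  have hseg : c ∈ segment ℝ β a := by
    rw [segment_eq_uIcc, mem_uIcc, hclamp]
    rcases le_total β (S.lowerEnd x b) with h1 | h1
    · left
      rw [max_eq_left ((min_le_left _ _).trans h1)]
      exact ⟨h1, ha.1⟩
    · rw [max_eq_right (le_min h1 (ha.1.trans ha.2))]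
      rcases le_total β (S.upperEnd b) with h2 | h2
      · rw [min_eq_left h2]; simpa using le_total β a
      · rw [min_eq_right h2]; exact Or.inr ⟨ha.2, h2⟩
  have := hφ.le_on_segment hβ.1 (control_subset x b ha) hseg
  rwa [max_eq_right (hβ.2 a (control_subset x b ha))] at this

/-- A minimizer of `p β + α f β` over `[0, Bmax]`. -/
def target (S : StorageModel M) (f : ℝ → ℝ) (p : ℝ) : ℝ := Classical.epsilon (S.IsTarget f p)

theorem isTarget_target {f : ℝ → ℝ} (hf : ContinuousOn f (Icc 0 S.Bmax)) (p : ℝ) :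
    S.IsTarget f p (S.target f p) := Classical.epsilon_spec (exists_isTarget hf p)

/-- This makes the arbitrary choice in `target` measurable in the price. -/
theorem antitone_target {f : ℝ → ℝ} (hf : ContinuousOn f (Icc 0 S.Bmax)) :
    Antitone (S.target f) := fun p q hpq => by
  rcases hpq.eq_or_lt with rfl | h
  · exact le_rfl
  · exact (isTarget_target hf p).le_of_lt (isTarget_target hf q) h

/-- Greedy next level with respect to the future cost `f`. -/
def greedy (S : StorageModel M) (f : ℝ → ℝ) (x : S.State) (b : ℝ) : ℝ :=
  S.thresholdAction x (S.target f (S.price x)) (S.target f (S.price x)) b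

/-- Least one-step cost with future cost `f`. -/
def stepValue (S : StorageModel M) (f : ℝ → ℝ) (x : S.State) (b : ℝ) : ℝ :=
  S.lookahead f x b (S.greedy f x b)

theorem greedy_mem_control (f : ℝ → ℝ) (x : S.State) {b : ℝ} (hb : b ∈ Icc 0 S.Bmax) :
    S.greedy f x b ∈ S.control x b := thresholdAction_mem_control x _ hb

theorem stepValue_le (hηc : S.ηc = 1) (hηd : S.ηd = 1) {f : ℝ → ℝ}
    (hf : ConvexOn ℝ (Icc 0 S.Bmax) f) (hf' : ContinuousOn f (Icc 0 S.Bmax)) {x : S.State}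
    {b a : ℝ} (hb : b ∈ Icc 0 S.Bmax) (ha : a ∈ S.control x b) :
    S.stepValue f x b ≤ S.lookahead f x b a :=
  (isTarget_target hf' _).lookahead_le hηc hηd hf hb ha

theorem IsTarget.stepValue_eq (hηc : S.ηc = 1) (hηd : S.ηd = 1) {f : ℝ → ℝ}
    (hf : ConvexOn ℝ (Icc 0 S.Bmax) f) (hf' : ContinuousOn f (Icc 0 S.Bmax)) {x : S.State}
    {β b : ℝ} (hβ : S.IsTarget f (S.price x) β) (hb : b ∈ Icc 0 S.Bmax) :
    S.stepValue f x b = S.lookahead f x b (S.thresholdAction x β β b) :=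
  le_antisymm (stepValue_le hηc hηd hf hf' hb (thresholdAction_mem_control x β hb))
    (hβ.lookahead_le hηc hηd hf hb (greedy_mem_control f x hb))

/-- Partial minimization of a jointly convex function: a convex combination of feasible moves is
feasible and costs at most the same combination of their costs. -/
theorem convexOn_stepValue (hηc : S.ηc = 1) (hηd : S.ηd = 1) (hconv : S.ConvexControl)
    {f : ℝ → ℝ} (hf : ConvexOn ℝ (Icc 0 S.Bmax) f) (hf' : ContinuousOn f (Icc 0 S.Bmax))
    (x : S.State) : ConvexOn ℝ (Icc 0 S.Bmax) (S.stepValue f x) := by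
  refine ⟨convex_Icc _ _, fun b₁ hb₁ b₂ hb₂ s t hs ht hst => ?_⟩
  have h₁ := greedy_mem_control f x hb₁
  have h₂ := greedy_mem_control f x hb₂
  refine (stepValue_le hηc hηd hf hf' (convex_Icc _ _ hb₁ hb₂ hs ht hst)
    (hconv.combo_mem x hb₁ hb₂ h₁ h₂ hs ht hst)).trans ?_
  have := mul_le_mul_of_nonneg_left
    (hf.2 (control_subset x _ h₁) (control_subset x _ h₂) hs ht hst) S.α_mem.1.le
  simp only [stepValue, lookahead, stageCost_eq hηc hηd, smul_eq_mul] at this ⊢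
  have hd : S.demand x = s * S.demand x + t * S.demand x := by rw [← add_mul, hst, one_mul]
  generalize S.demand x = d at *
  generalize S.price x = p at *
  have hp : (d + (s * S.greedy f x b₁ + t * S.greedy f x b₂ - (s * b₁ + t * b₂))) * p =
      s * ((d + (S.greedy f x b₁ - b₁)) * p) + t * ((d + (S.greedy f x b₂ - b₂)) * p) := by
    linear_combination p * hd
  linarith

theorem measurable_stageCost : Measurable fun q : S.State × ℝ => S.stageCost q.1 q.2 := by
  have := measurable_demand (S := S)
  have := measurable_price (S := S)
  unfold stageCost
  fun_prop

theorem continuous_stepValue (hconv : S.ConvexControl) {f : ℝ → ℝ} (hf : Continuous f)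
    (x : S.State) : Continuous fun b => S.stepValue f x (S.clip b) := by
  have h := hconv.continuous_thresholdAction x (S.target f (S.price x))
  have := continuous_clip (S := S)
  unfold stepValue lookahead stageCost greedy
  fun_prop

theorem measurable_greedy {f : ℝ → ℝ} (hf : Continuous f) {b : ℝ} (hb : b ∈ Icc 0 S.Bmax) :
    Measurable fun x => S.greedy f x b :=
  measurable_thresholdAction ((antitone_target hf.continuousOn).measurable.comp measurable_price) hb

theorem measurable_stepValue {f : ℝ → ℝ} (hf : Continuous f) {b : ℝ} (hb : b ∈ Icc 0 S.Bmax) :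
    Measurable fun x => S.stepValue f x b := by
  have h := measurable_greedy hf hb
  exact (measurable_stageCost.comp (measurable_id.prodMk (h.sub_const b))).add
    ((hf.measurable.comp h).const_mul _)

theorem measurable_stepValue_uncurry (hconv : S.ConvexControl) {f : ℝ → ℝ} (hf : Continuous f) :
    Measurable fun q : ℝ × S.State => S.stepValue f q.2 (S.clip q.1) :=
  measurable_uncurry_of_continuous_of_measurable
    (u := fun b x => S.stepValue f x (S.clip b))
    (fun x => continuous_stepValue hconv hf x) fun b => measurable_stepValue hf (clip_mem b)

theorem exists_stageCost_bound (S : StorageModel M) :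
    ∃ C, 0 ≤ C ∧ ∀ (x : S.State) (b a : ℝ), b ∈ Icc 0 S.Bmax → a ∈ Icc 0 S.Bmax →
      |S.stageCost x (a - b)| ≤ C := by
  obtain ⟨d, hd⟩ := S.D_compact.isBounded.exists_norm_le
  obtain ⟨p, hp⟩ := S.P_compact.isBounded.exists_norm_le
  have hc := inv_nonneg.2 S.ηc_mem.1.le
  have hd0 : 0 ≤ d := (norm_nonneg _).trans (hd _ S.D_nonempty.some_mem)
  have hp0 : 0 ≤ p := (norm_nonneg _).trans (hp _ S.P_nonempty.some_mem)
  have hB := S.Bmax_nonneg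
  refine ⟨(d + S.ηc⁻¹ * S.Bmax + S.ηd * S.Bmax) * p, by have := S.ηd_mem.1; positivity, ?_⟩
  intro x b a hb ha
  rw [stageCost, abs_mul]
  refine mul_le_mul ?_ (hp _ x.2.1.2) (abs_nonneg _)
    (by have := S.ηd_mem.1; positivity)
  have h1 : |S.demand x| ≤ d := hd _ x.1.2
  have h2 : |S.ηc⁻¹ * max (a - b) 0| ≤ S.ηc⁻¹ * S.Bmax := by
    rw [abs_of_nonneg (mul_nonneg hc (le_max_right _ _))]
    exact mul_le_mul_of_nonneg_left (max_le (by linarith [ha.2, hb.1]) hB) hc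
  have h3 : |S.ηd * max (-(a - b)) 0| ≤ S.ηd * S.Bmax := by
    rw [abs_of_nonneg (mul_nonneg S.ηd_mem.1.le (le_max_right _ _))]
    exact mul_le_mul_of_nonneg_left (max_le (by linarith [hb.2, ha.1]) hB) S.ηd_mem.1.le
  exact (abs_sub _ _).trans (add_le_add ((abs_add_le _ _).trans (add_le_add h1 h2)) h3)

end StorageModel

/-! ### The Bellman operator and its fixed point. -/

namespace StorageModel

variable {M : Type*} [MeasurableSpace M] {S : StorageModel M}

open scoped BoundedContinuousFunction

theorem abs_stepValue_le {C : ℝ}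
    (hC : ∀ (x : S.State) (b a : ℝ), b ∈ Icc 0 S.Bmax → a ∈ Icc 0 S.Bmax →
      |S.stageCost x (a - b)| ≤ C) (f : ℝ →ᵇ ℝ) (x : S.State) {b : ℝ} (hb : b ∈ Icc 0 S.Bmax) :
    |S.stepValue f x b| ≤ C + S.α * ‖f‖ := by
  refine (abs_add_le _ _).trans (add_le_add
    (hC x b _ hb (control_subset x _ (greedy_mem_control f x hb))) ?_)
  rw [abs_mul, abs_of_pos S.α_mem.1]
  exact mul_le_mul_of_nonneg_left (f.norm_coe_le_norm _) S.α_mem.1.le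

theorem integrable_stepValue (f : ℝ →ᵇ ℝ) {b : ℝ} (hb : b ∈ Icc 0 S.Bmax)
    (μ : Measure S.State) [IsFiniteMeasure μ] : Integrable (fun x => S.stepValue f x b) μ := by
  obtain ⟨C, -, hC⟩ := exists_stageCost_bound S
  exact Integrable.of_bound (measurable_stepValue f.continuous hb).aestronglyMeasurable
    (C + S.α * ‖f‖) (ae_of_all _ fun x => abs_stepValue_le hC f x hb)

/-- The greedy action for `g` is feasible in the problem for `f`, and replacing the future cost
changes the total by at most `α * dist f g`. Exchanging `f` and `g` gives the contraction estimate.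
-/
theorem stepValue_le_add (hηc : S.ηc = 1) (hηd : S.ηd = 1) {f g : ℝ →ᵇ ℝ}
    (hf : ConvexOn ℝ (Icc 0 S.Bmax) f) (x : S.State) {b : ℝ} (hb : b ∈ Icc 0 S.Bmax) :
    S.stepValue f x b ≤ S.stepValue g x b + S.α * dist f g := by
  refine (stepValue_le hηc hηd hf f.continuous.continuousOn hb
    (greedy_mem_control g x hb)).trans ?_
  have h : f (S.greedy g x b) ≤ g (S.greedy g x b) + dist f g := by
    have := (le_abs_self _).trans (f.dist_coe_le_dist (g := g) (S.greedy g x b))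
    linarith
  have := mul_le_mul_of_nonneg_left h S.α_mem.1.le
  rw [stepValue, lookahead, lookahead]
  linarith

theorem dist_integral_stepValue_le (hηc : S.ηc = 1) (hηd : S.ηd = 1) {f g : ℝ →ᵇ ℝ}
    (hf : ConvexOn ℝ (Icc 0 S.Bmax) f) (hg : ConvexOn ℝ (Icc 0 S.Bmax) g)
    (μ : Measure S.State) [IsProbabilityMeasure μ] {b : ℝ} (hb : b ∈ Icc 0 S.Bmax) :
    dist (∫ x, S.stepValue f x b ∂μ) (∫ x, S.stepValue g x b ∂μ) ≤ S.α * dist f g := by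
  rw [Real.dist_eq, ← integral_sub (integrable_stepValue f hb μ) (integrable_stepValue g hb μ)]
  have h : ∀ x, ‖S.stepValue f x b - S.stepValue g x b‖ ≤ S.α * dist f g := fun x => by
    have h1 := stepValue_le_add (g := g) hηc hηd hf x hb
    have h2 := stepValue_le_add (g := f) hηc hηd hg x hb
    rw [dist_comm] at h2
    exact abs_le.2 ⟨by linarith, by linarith⟩
  simpa using norm_integral_le_of_norm_le_const (μ := μ) (ae_of_all _ h)

theorem convexOn_integral_stepValue (hηc : S.ηc = 1) (hηd : S.ηd = 1) (hconv : S.ConvexControl)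
    {f : ℝ →ᵇ ℝ} (hf : ConvexOn ℝ (Icc 0 S.Bmax) f) (μ : Measure S.State)
    [IsFiniteMeasure μ] :
    ConvexOn ℝ (Icc 0 S.Bmax) fun b => ∫ x, S.stepValue f x (S.clip b) ∂μ := by
  refine ⟨convex_Icc _ _, fun b₁ hb₁ b₂ hb₂ s t hs ht hst => ?_⟩
  have hb : s * b₁ + t * b₂ ∈ Icc 0 S.Bmax := convex_Icc _ _ hb₁ hb₂ hs ht hst
  have h₁ := integrable_stepValue f hb₁ μ
  have h₂ := integrable_stepValue f hb₂ μ
  simp only [smul_eq_mul, clip_of_mem hb, clip_of_mem hb₁, clip_of_mem hb₂]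
  rw [← integral_const_mul, ← integral_const_mul,
    ← integral_add (h₁.const_mul s) (h₂.const_mul t)]
  refine integral_mono (integrable_stepValue f hb μ) ((h₁.const_mul s).add (h₂.const_mul t)) ?_
  exact fun x => (convexOn_stepValue hηc hηd hconv hf f.continuous.continuousOn x).2 hb₁ hb₂ hs ht hst

theorem continuous_integral_stepValue (hconv : S.ConvexControl) (f : ℝ →ᵇ ℝ)
    (μ : Measure S.State) [IsFiniteMeasure μ] :
    Continuous fun b => ∫ x, S.stepValue f x (S.clip b) ∂μ := by
  obtain ⟨C, -, hC⟩ := exists_stageCost_bound S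
  exact continuous_of_dominated
    (fun b => (measurable_stepValue f.continuous (clip_mem b)).aestronglyMeasurable)
    (bound := fun _ => C + S.α * ‖f‖)
    (fun b => ae_of_all _ fun x => abs_stepValue_le hC f x (clip_mem b))
    (integrable_const _) (ae_of_all _ fun x => continuous_stepValue hconv f.continuous x)

/-- The dynamic programming equation has a bounded continuous convex solution when the exogenous
states are drawn from `μ` independently in every slot. -/
theorem exists_fixedPoint (hηc : S.ηc = 1) (hηd : S.ηd = 1) (hconv : S.ConvexControl)
    (μ : Measure S.State) [IsProbabilityMeasure μ] :
    ∃ f : ℝ →ᵇ ℝ, ConvexOn ℝ (Icc 0 S.Bmax) f ∧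
      ∀ b ∈ Icc 0 S.Bmax, f b = ∫ x, S.stepValue f x b ∂μ := by
  obtain ⟨C, -, hC⟩ := exists_stageCost_bound S
  -- The contraction is run on convex functions because the optimality of the greedy action, on
  -- which the estimate rests, uses convexity. `K` is cut out by pointwise inequalities, hence
  -- closed and complete.
  let K : Set (ℝ →ᵇ ℝ) := {f | ConvexOn ℝ (Icc 0 S.Bmax) f}
  have hK : IsClosed K := by
    have : K = ⋂ (x ∈ Icc 0 S.Bmax) (y ∈ Icc 0 S.Bmax) (s : ℝ) (t : ℝ) (_ : 0 ≤ s) (_ : 0 ≤ t)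
        (_ : s + t = 1), {f : ℝ →ᵇ ℝ | f (s • x + t • y) ≤ s • f x + t • f y} := by
      ext f
      simp only [K, ConvexOn, convex_Icc, true_and, mem_iInter]
      exact ⟨fun h x hx y hy s t hs ht hst => h hx hy hs ht hst,
        fun h x hx y hy s t hs ht hst => h x hx y hy s t hs ht hst⟩
    rw [this]
    repeat refine isClosed_iInter fun _ => ?_
    exact isClosed_le (by fun_prop) (by fun_prop)
  let T : (ℝ →ᵇ ℝ) → (ℝ →ᵇ ℝ) := fun f => BoundedContinuousFunction.ofNormedAddCommGroup
    (fun b => ∫ x, S.stepValue f x (S.clip b) ∂μ) (continuous_integral_stepValue hconv f μ)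
    (C + S.α * ‖f‖) fun b => (norm_integral_le_of_norm_le_const (μ := μ)
      (ae_of_all _ fun x => abs_stepValue_le hC f x (clip_mem b))).trans (by simp)
  have hT : MapsTo T K K := fun f hf => convexOn_integral_stepValue hηc hηd hconv hf μ
  have hcontr : ContractingWith ⟨S.α, S.α_mem.1.le⟩ (hT.restrict T K K) := by
    refine ⟨S.α_mem.2, LipschitzWith.of_dist_le_mul fun f g => ?_⟩
    refine (BoundedContinuousFunction.dist_le
      (mul_nonneg S.α_mem.1.le dist_nonneg)).2 fun b => ?_
    exact dist_integral_stepValue_le hηc hηd f.2 g.2 μ (clip_mem b)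
  obtain ⟨f, hf, hfix, -⟩ := ContractingWith.exists_fixedPoint' hK.isComplete hT hcontr
    (x := 0) (convexOn_const (0 : ℝ) (convex_Icc _ _)) (edist_ne_top _ _)
  refine ⟨f, hf, fun b hb => ?_⟩
  have : T f b = f b := by rw [hfix]
  rw [← this]
  simp [T, clip_of_mem hb]

/-- The integrand factors through the pair of demand and price as `W`, so only the law of that pair
matters; the modulating state may still evolve in a state-dependent way. -/
theorem IIDDemandPrice.integral_stepValue_eq (hiid : S.IIDDemandPrice) {f : ℝ → ℝ}
    (hf : Continuous f) {b : ℝ} (hb : b ∈ Icc 0 S.Bmax) (x x' : S.State) :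
    ∫ y, S.stepValue f y b ∂S.κ x = ∫ y, S.stepValue f y b ∂S.κ x' := by
  let a : ℝ × ℝ → ℝ := fun q =>
    max (max 0 (max (b - q.1 / S.ηd) (b - S.Ad b))) (min (S.target f q.2) (S.upperEnd b))
  let W : ℝ × ℝ → ℝ := fun q =>
    (q.1 + S.ηc⁻¹ * max (a q - b) 0 - S.ηd * max (-(a q - b)) 0) * q.2 + S.α * f (a q)
  have hW : Measurable W := by
    have := (antitone_target (S := S) hf.continuousOn).measurable
    have := hf.measurable
    fun_prop
  have hVW : (fun y => S.stepValue f y b) = fun y => W (S.demand y, S.price y) := by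
    funext y
    simp only [stepValue, lookahead, greedy, thresholdAction_eq y _ hb]
    rfl
  have hm : Measurable fun y : S.State => (S.demand y, S.price y) :=
    measurable_demand.prodMk measurable_price
  rw [hVW, ← integral_map hm.aemeasurable hW.aestronglyMeasurable, hiid x x',
    integral_map hm.aemeasurable hW.aestronglyMeasurable]

end StorageModel

/-! ### Unrolling discounted recursions. -/

theorem le_tsum_of_le_add_mul {a c : ℕ → ℝ} {r A C : ℝ} (hr : r ∈ Ioo (0 : ℝ) 1)
    (ha : ∀ n, |a n| ≤ A) (hc : ∀ n, |c n| ≤ C) (h : ∀ n, a n ≤ c n + r * a (n + 1)) :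
    a 0 ≤ ∑' n, r ^ n * c n := by
  have hsum : Summable fun n => r ^ n * c n := by
    refine Summable.of_norm_bounded
      ((summable_geometric_of_lt_one hr.1.le hr.2).mul_right C) fun n => ?_
    rw [Real.norm_eq_abs, abs_mul, abs_of_pos (pow_pos hr.1 n)]
    exact mul_le_mul_of_nonneg_left (hc n) (pow_pos hr.1 n).le
  -- Iterating the recursion leaves the remainder `r ^ n * a n`, which vanishes because `a` is
  -- bounded.
  have hpart (n : ℕ) : a 0 ≤ ∑ i ∈ Finset.range n, r ^ i * c i + r ^ n * a n := by
    induction n with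
    | zero => simp
    | succ n ih =>
      have := mul_le_mul_of_nonneg_left (h n) (pow_pos hr.1 n).le
      rw [Finset.sum_range_succ, pow_succ]
      linarith
  have htail : Filter.Tendsto (fun n => r ^ n * a n) Filter.atTop (nhds 0) := by
    refine squeeze_zero_norm (a := fun n => r ^ n * A) (fun n => ?_) ?_
    · rw [Real.norm_eq_abs, abs_mul, abs_of_pos (pow_pos hr.1 n)]
      exact mul_le_mul_of_nonneg_left (ha n) (pow_pos hr.1 n).le
    · simpa using (tendsto_pow_atTop_nhds_zero_of_lt_one hr.1.le hr.2).mul_const A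
  simpa using ge_of_tendsto' (hsum.hasSum.tendsto_sum_nat.add htail) hpart

theorem eq_tsum_of_eq_add_mul {a c : ℕ → ℝ} {r A C : ℝ} (hr : r ∈ Ioo (0 : ℝ) 1)
    (ha : ∀ n, |a n| ≤ A) (hc : ∀ n, |c n| ≤ C) (h : ∀ n, a n = c n + r * a (n + 1)) :
    a 0 = ∑' n, r ^ n * c n := by
  refine le_antisymm (le_tsum_of_le_add_mul hr ha hc fun n => (h n).le) ?_
  have := le_tsum_of_le_add_mul (a := fun n => -a n) (c := fun n => -c n) hr
    (by simpa using ha) (by simpa using hc) fun n => by linarith [h n]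
  simp only [mul_neg, tsum_neg] at this
  linarith

/-! ### Verification along trajectories of the exogenous chain. -/

namespace StorageModel

variable {M : Type*} [MeasurableSpace M] {S : StorageModel M}

open scoped BoundedContinuousFunction

instance (x : S.State) : IsProbabilityMeasure (S.pathLaw x) := by
  unfold pathLaw; infer_instance

theorem integral_pathLaw_zero (x : S.State) {F : S.State → ℝ} (hF : Measurable F) :
    ∫ ω, F (ω 0) ∂S.pathLaw x = F x := by
  have h0 : Measurable fun u : (i : Finset.Iic 0) → S.State => F (u ⟨0, by simp⟩) :=
    hF.comp (measurable_pi_apply _)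
  have := integral_map (μ := S.pathLaw x) (φ := Preorder.frestrictLe (π := fun _ => S.State) 0)
    (Preorder.measurable_frestrictLe 0).aemeasurable h0.aestronglyMeasurable
  rw [pathLaw, Kernel.traj_map_frestrictLe_apply, Kernel.partialTraj_self, Kernel.id_apply,
    integral_dirac' _ _ h0.stronglyMeasurable] at this
  exact this.symm

/-- Given the exogenous states up to time `n`, the next one has law `κ (ω n)`. -/
theorem integral_pathLaw_succ (x : S.State) (n : ℕ)
    {Φ : ((i : Finset.Iic n) → S.State) × S.State → ℝ} (hΦ : Measurable Φ) {C : ℝ}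
    (hC : ∀ q, ‖Φ q‖ ≤ C) :
    ∫ ω, Φ (Preorder.frestrictLe (π := fun _ => S.State) n ω, ω (n + 1)) ∂S.pathLaw x =
      ∫ u, ∫ y, Φ (u, y) ∂S.κ (u ⟨n, by simp⟩)
        ∂(S.pathLaw x).map (Preorder.frestrictLe (π := fun _ => S.State) n) := by
  let κ' (n : ℕ) : Kernel ((i : Finset.Iic n) → S.State) S.State :=
    S.κ.comap (fun h => h ⟨n, by simp⟩) (measurable_pi_apply _)
  let u₀ : (i : Finset.Iic 0) → S.State := fun _ => x
  have hlaw : ((S.pathLaw x).map (Preorder.frestrictLe (π := fun _ => S.State) n)) ⊗ₘ κ' n =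
      (S.pathLaw x).map fun ω =>
        (Preorder.frestrictLe (π := fun _ => S.State) n ω, ω (n + 1)) := by
    refine Eq.trans ?_ (Kernel.partialTraj_compProd_eq_map_traj (X := fun _ => S.State) (κ := κ')
      (Nat.zero_le n) (x₀ := u₀))
    rw [← Kernel.traj_map_frestrictLe_apply]
    rfl
  have hmeas : Measurable fun ω : ℕ → S.State =>
      (Preorder.frestrictLe (π := fun _ => S.State) n ω, ω (n + 1)) :=
    (Preorder.measurable_frestrictLe n).prodMk (measurable_pi_apply _)
  rw [← integral_map hmeas.aemeasurable hΦ.aestronglyMeasurable, ← hlaw]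
  have := Measure.isProbabilityMeasure_map (μ := S.pathLaw x)
    (Preorder.measurable_frestrictLe (X := fun _ => S.State) n).aemeasurable
  exact Measure.integral_compProd
    (Integrable.of_bound hΦ.aestronglyMeasurable C (ae_of_all _ hC))

namespace Admissible

variable {b : ℝ} {B : ℕ → (ℕ → S.State) → ℝ}

theorem mem_Icc (hB : S.Admissible b B) (hb : b ∈ Icc 0 S.Bmax) (t : ℕ) (ω : ℕ → S.State) :
    B t ω ∈ Icc 0 S.Bmax := by
  cases t with
  | zero => rwa [hB.init]
  | succ t => exact control_subset _ _ (hB.feasible t ω)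

theorem measurable (hB : S.Admissible b B) (t : ℕ) : Measurable (B t) := by
  cases t with
  | zero => rw [funext hB.init]; exact measurable_const
  | succ t => exact (hB.adapted t).mono (Filtration.le _ t) le_rfl

theorem measurable_stageCost (hB : S.Admissible b B) (t : ℕ) :
    Measurable fun ω => S.stageCost (ω t) (B (t + 1) ω - B t ω) :=
  StorageModel.measurable_stageCost.comp
    ((measurable_pi_apply t).prodMk ((hB.measurable (t + 1)).sub (hB.measurable t)))

theorem cost_eq (hB : S.Admissible b B) (hb : b ∈ Icc 0 S.Bmax) (x : S.State) :
    S.cost x B =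
      ∑' t, S.α ^ t * ∫ ω, S.stageCost (ω t) (B (t + 1) ω - B t ω) ∂S.pathLaw x := by
  obtain ⟨C, hC0, hC⟩ := exists_stageCost_bound S
  have hbound (t : ℕ) (ω : ℕ → S.State) :
      ‖S.α ^ t * S.stageCost (ω t) (B (t + 1) ω - B t ω)‖ ≤ S.α ^ t * C := by
    rw [Real.norm_eq_abs, abs_mul, abs_of_pos (pow_pos S.α_mem.1 t)]
    exact mul_le_mul_of_nonneg_left (hC _ _ _ (hB.mem_Icc hb _ _) (hB.mem_Icc hb _ _))
      (pow_pos S.α_mem.1 t).le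
  have hint (t : ℕ) : Integrable
      (fun ω => S.α ^ t * S.stageCost (ω t) (B (t + 1) ω - B t ω)) (S.pathLaw x) :=
    Integrable.of_bound ((hB.measurable_stageCost t).const_mul _).aestronglyMeasurable _
      (ae_of_all _ (hbound t))
  simp only [cost, ← integral_const_mul]
  refine (integral_tsum_of_summable_integral_norm hint ?_).symm
  refine Summable.of_nonneg_of_le (fun t => integral_nonneg fun ω => norm_nonneg _) (fun t => ?_)
    ((summable_geometric_of_lt_one S.α_mem.1.le S.α_mem.2).mul_right C)
  simpa using integral_mono (hint t).norm (integrable_const (S.α ^ t * C)) (hbound t)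

/-- Nonanticipativity enters here: `B (n + 1)` is a function `h` of the history up to time `n`, so
it is fixed while the next state is averaged under `κ (ω n)`, and the Bellman equation evaluates
that average. -/
theorem integral_stepValue_succ (hB : S.Admissible b B) (hb : b ∈ Icc 0 S.Bmax)
    (hconv : S.ConvexControl) {f : ℝ →ᵇ ℝ}
    (hf : ∀ x, ∀ b ∈ Icc 0 S.Bmax, f b = ∫ y, S.stepValue f y b ∂S.κ x) (x : S.State) (n : ℕ) :
    ∫ ω, S.stepValue f (ω (n + 1)) (B (n + 1) ω) ∂S.pathLaw x =
      ∫ ω, f (B (n + 1) ω) ∂S.pathLaw x := by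
  obtain ⟨C, -, hC⟩ := exists_stageCost_bound S
  have had := hB.adapted n
  rw [Filtration.piLE_eq_comap_frestrictLe] at had
  obtain ⟨h, hh, hBh⟩ := had.exists_eq_measurable_comp
  have hval (ω : ℕ → S.State) :
      S.clip (h (Preorder.frestrictLe (π := fun _ => S.State) n ω)) = B (n + 1) ω := by
    rw [← clip_of_mem (hB.mem_Icc hb (n + 1) ω), hBh]; rfl
  have hΦ : Measurable fun q : ((i : Finset.Iic n) → S.State) × S.State =>
      S.stepValue f q.2 (S.clip (h q.1)) :=
    (measurable_stepValue_uncurry hconv f.continuous).comp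
      ((hh.comp measurable_fst).prodMk measurable_snd)
  have hnext := integral_pathLaw_succ x n hΦ
    fun q => abs_stepValue_le hC f q.2 (clip_mem (h q.1))
  simp only [hval, ← hf _ _ (clip_mem _)] at hnext
  rw [hnext, integral_map (Preorder.measurable_frestrictLe n).aemeasurable
    (f.continuous.measurable.comp (continuous_clip.measurable.comp hh)).aestronglyMeasurable]
  simp only [hval]

theorem integrable_stepValue (hB : S.Admissible b B) (hb : b ∈ Icc 0 S.Bmax)
    (hconv : S.ConvexControl) (f : ℝ →ᵇ ℝ) (x : S.State) (n : ℕ) :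
    Integrable (fun ω => S.stepValue f (ω n) (B n ω)) (S.pathLaw x) := by
  obtain ⟨C, -, hC⟩ := exists_stageCost_bound S
  have hmeas : Measurable fun ω => S.stepValue f (ω n) (B n ω) := by
    have := (measurable_stepValue_uncurry hconv f.continuous).comp
      ((hB.measurable n).prodMk (measurable_pi_apply n))
    simpa only [Function.comp_def, clip_of_mem (hB.mem_Icc hb n _)] using this
  exact Integrable.of_bound hmeas.aestronglyMeasurable (C + S.α * ‖f‖)
    (ae_of_all _ fun ω => abs_stepValue_le hC f _ (hB.mem_Icc hb n ω))

theorem integrable_stageCost (hB : S.Admissible b B) (hb : b ∈ Icc 0 S.Bmax) (x : S.State)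
    (n : ℕ) : Integrable (fun ω => S.stageCost (ω n) (B (n + 1) ω - B n ω)) (S.pathLaw x) := by
  obtain ⟨C, -, hC⟩ := exists_stageCost_bound S
  exact Integrable.of_bound (hB.measurable_stageCost n).aestronglyMeasurable C
    (ae_of_all _ fun ω => hC _ _ _ (hB.mem_Icc hb _ _) (hB.mem_Icc hb _ _))

theorem integrable_comp (hB : S.Admissible b B) (f : ℝ →ᵇ ℝ) (x : S.State) (n : ℕ) :
    Integrable (fun ω => f (B n ω)) (S.pathLaw x) :=
  Integrable.of_bound (f.continuous.measurable.comp (hB.measurable n)).aestronglyMeasurable ‖f‖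
    (ae_of_all _ fun _ => f.norm_coe_le_norm _)

theorem integral_lookahead (hB : S.Admissible b B) (hb : b ∈ Icc 0 S.Bmax)
    (hconv : S.ConvexControl) {f : ℝ →ᵇ ℝ}
    (hf : ∀ x, ∀ b ∈ Icc 0 S.Bmax, f b = ∫ y, S.stepValue f y b ∂S.κ x) (x : S.State) (n : ℕ) :
    ∫ ω, S.lookahead f (ω n) (B n ω) (B (n + 1) ω) ∂S.pathLaw x =
      ∫ ω, S.stageCost (ω n) (B (n + 1) ω - B n ω) ∂S.pathLaw x +
        S.α * ∫ ω, S.stepValue f (ω (n + 1)) (B (n + 1) ω) ∂S.pathLaw x := by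
  rw [hB.integral_stepValue_succ hb hconv hf, ← integral_const_mul,
    ← integral_add (hB.integrable_stageCost hb x n) ((hB.integrable_comp f x (n + 1)).const_mul _)]
  rfl

theorem abs_integral_stepValue_le (hB : S.Admissible b B) (hb : b ∈ Icc 0 S.Bmax) {C : ℝ}
    (hC : ∀ (x : S.State) (b a : ℝ), b ∈ Icc 0 S.Bmax → a ∈ Icc 0 S.Bmax →
      |S.stageCost x (a - b)| ≤ C) (f : ℝ →ᵇ ℝ) (x : S.State) (n : ℕ) :
    |∫ ω, S.stepValue f (ω n) (B n ω) ∂S.pathLaw x| ≤ C + S.α * ‖f‖ := by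
  simpa using norm_integral_le_of_norm_le_const (μ := S.pathLaw x)
    (f := fun ω => S.stepValue f (ω n) (B n ω))
    (ae_of_all _ fun ω => abs_stepValue_le hC f _ (hB.mem_Icc hb n ω))

theorem abs_integral_stageCost_le (hB : S.Admissible b B) (hb : b ∈ Icc 0 S.Bmax) {C : ℝ}
    (hC : ∀ (x : S.State) (b a : ℝ), b ∈ Icc 0 S.Bmax → a ∈ Icc 0 S.Bmax →
      |S.stageCost x (a - b)| ≤ C) (x : S.State) (n : ℕ) :
    |∫ ω, S.stageCost (ω n) (B (n + 1) ω - B n ω) ∂S.pathLaw x| ≤ C := by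
  simpa using norm_integral_le_of_norm_le_const (μ := S.pathLaw x)
    (f := fun ω => S.stageCost (ω n) (B (n + 1) ω - B n ω))
    (ae_of_all _ fun ω => hC _ _ _ (hB.mem_Icc hb _ _) (hB.mem_Icc hb _ _))

theorem integral_stepValue_zero (hB : S.Admissible b B) (hb : b ∈ Icc 0 S.Bmax) (f : ℝ →ᵇ ℝ)
    (x : S.State) : ∫ ω, S.stepValue f (ω 0) (B 0 ω) ∂S.pathLaw x = S.stepValue f x b := by
  simp only [hB.init]
  exact integral_pathLaw_zero x (measurable_stepValue f.continuous hb)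

/-- Lower bound half of the verification theorem. -/
theorem stepValue_le_cost (hB : S.Admissible b B) (hb : b ∈ Icc 0 S.Bmax)
    (hηc : S.ηc = 1) (hηd : S.ηd = 1) (hconv : S.ConvexControl) {f : ℝ →ᵇ ℝ}
    (hcvx : ConvexOn ℝ (Icc 0 S.Bmax) f)
    (hf : ∀ x, ∀ b ∈ Icc 0 S.Bmax, f b = ∫ y, S.stepValue f y b ∂S.κ x) (x : S.State) :
    S.stepValue f x b ≤ S.cost x B := by
  obtain ⟨C, -, hC⟩ := exists_stageCost_bound S
  rw [hB.cost_eq hb, ← hB.integral_stepValue_zero hb f x]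
  refine le_tsum_of_le_add_mul (a := fun n => ∫ ω, S.stepValue f (ω n) (B n ω) ∂S.pathLaw x)
    S.α_mem (hB.abs_integral_stepValue_le hb hC f x) (hB.abs_integral_stageCost_le hb hC x)
    fun n => ?_
  -- The recursion for the expected values thus reduces to the pointwise minimality of `stepValue`
  -- among feasible moves.
  rw [← hB.integral_lookahead hb hconv hf]
  exact integral_mono (hB.integrable_stepValue hb hconv f x n)
    ((hB.integrable_stageCost hb x n).add ((hB.integrable_comp f x (n + 1)).const_mul _))
    fun ω => stepValue_le hηc hηd hcvx f.continuous.continuousOn (hB.mem_Icc hb n ω)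
      (hB.feasible n ω)

/-- Equality half of the verification theorem. -/
theorem cost_eq_stepValue (hB : S.Admissible b B) (hb : b ∈ Icc 0 S.Bmax)
    (hconv : S.ConvexControl) {f : ℝ →ᵇ ℝ}
    (hf : ∀ x, ∀ b ∈ Icc 0 S.Bmax, f b = ∫ y, S.stepValue f y b ∂S.κ x)
    (hopt : ∀ n ω, S.stepValue f (ω n) (B n ω) = S.lookahead f (ω n) (B n ω) (B (n + 1) ω))
    (x : S.State) : S.cost x B = S.stepValue f x b := by
  obtain ⟨C, -, hC⟩ := exists_stageCost_bound S
  rw [hB.cost_eq hb, ← hB.integral_stepValue_zero hb f x]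
  refine (eq_tsum_of_eq_add_mul (a := fun n => ∫ ω, S.stepValue f (ω n) (B n ω) ∂S.pathLaw x)
    S.α_mem (hB.abs_integral_stepValue_le hb hC f x) (hB.abs_integral_stageCost_le hb hC x)
    fun n => ?_).symm
  rw [← hB.integral_lookahead hb hconv hf]
  simp only [hopt n]

end Admissible

theorem ConvexControl.admissible_thresholdPath (hconv : S.ConvexControl) {β : S.State → ℝ}
    (hβ : Measurable β) {b : ℝ} (hb : b ∈ Icc 0 S.Bmax) :
    S.Admissible b (S.thresholdPath β β b) := by
  have hmem (t : ℕ) (ω : ℕ → S.State) : S.thresholdPath β β b t ω ∈ Icc 0 S.Bmax := by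
    induction t with
    | zero => exact hb
    | succ t ih => exact control_subset _ _ (thresholdAction_mem_control _ _ ih)
  -- The level at time `t + 1` needs only information up to time `t`. In the induction the level at
  -- `t + 1` is therefore viewed in the larger σ-algebra of time `t + 1` before the next step.
  have hstep (t : ℕ)
      (ht : Measurable[Filtration.piLE (X := fun _ : ℕ => S.State) t]
        (S.thresholdPath β β b t)) :
      Measurable[Filtration.piLE (X := fun _ : ℕ => S.State) t]
        (S.thresholdPath β β b (t + 1)) := by
    have hω : Measurable[Filtration.piLE (X := fun _ : ℕ => S.State) t]
        fun ω : ℕ → S.State => ω t := by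
      rw [Filtration.piLE_eq_comap_frestrictLe]
      exact Measurable.comp (g := fun h : (i : Finset.Iic t) → S.State => h ⟨t, by simp⟩)
        (measurable_pi_apply _) (comap_measurable _)
    have := (hconv.measurable_thresholdAction_uncurry hβ).comp (ht.prodMk hω)
    simp only [Function.comp_def, clip_of_mem (hmem t _)] at this
    exact this
  refine ⟨fun _ => rfl, fun t => ?_, fun t ω => thresholdAction_mem_control _ _ (hmem t ω)⟩
  induction t with
  | zero => exact hstep 0 measurable_const
  | succ t ih => exact hstep _ (ih.mono (Filtration.mono _ t.le_succ) le_rfl)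

end StorageModel

/-! ### Thresholds as minimizers, and identification of the value function. -/

namespace StorageModel

variable {M : Type*} [MeasurableSpace M] {S : StorageModel M}

open scoped BoundedContinuousFunction

theorem IsTarget.congr {f g : ℝ → ℝ} (hfg : EqOn f g (Icc 0 S.Bmax)) {p β : ℝ}
    (h : S.IsTarget f p β) : S.IsTarget g p β :=
  ⟨h.1, fun β' hβ' => by rw [← hfg h.1, ← hfg hβ']; exact h.2 β' hβ'⟩

/-- Fermat's rule for the minimization over `[0, Bmax]`, with the subdifferential relative to that
interval so that the endpoints need no separate treatment. -/
theorem isTarget_G_iff {x : S.State} {p β : ℝ} :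
    S.IsTarget (S.G x) p β ↔ β ∈ Icc 0 S.Bmax ∧ -p / S.α ∈ S.subdiffG x β := by
  refine and_congr_right fun _ => forall₂_congr fun β' _ => ?_
  have hα := S.α_mem.1
  have h : S.α * (S.G x β + -p / S.α * (β' - β)) = S.α * S.G x β - p * (β' - β) := by
    field_simp
    ring
  rw [← mul_le_mul_iff_right₀ (b := S.G x β + _) hα, h]
  constructor <;> intro h <;> linarith

/-- If the slope `p + α g` at `β` does not descend towards a minimizer `m`, the subgradient
inequality puts the value at `β` no higher than at `m`. -/
theorem IsTarget.of_subgradient {x : S.State} {p g m β : ℝ} (hm : S.IsTarget (S.G x) p m)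
    (hβ : β ∈ Icc 0 S.Bmax) (hg : g ∈ S.subdiffG x β) (h : 0 ≤ (p + S.α * g) * (m - β)) :
    S.IsTarget (S.G x) p β := by
  refine ⟨hβ, fun β' hβ' => le_trans ?_ (hm.2 β' hβ')⟩
  have := mul_le_mul_of_nonneg_left (hg m hm.1) S.α_mem.1.le
  linarith

theorem exists_isLeast_isGreatest_isTarget {f : ℝ → ℝ} (hf : ContinuousOn f (Icc 0 S.Bmax))
    (p : ℝ) : ∃ m₁ m₂, IsLeast {β | S.IsTarget f p β} m₁ ∧ IsGreatest {β | S.IsTarget f p β} m₂ := by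
  obtain ⟨m, hm⟩ := exists_isTarget hf p
  have hcl : IsClosed (Icc 0 S.Bmax ∩ (fun β => p * β + S.α * f β) ⁻¹' Iic (p * m + S.α * f m)) :=
    ContinuousOn.preimage_isClosed_of_isClosed (by fun_prop) isClosed_Icc isClosed_Iic
  have heq : {β | S.IsTarget f p β} =
      Icc 0 S.Bmax ∩ (fun β => p * β + S.α * f β) ⁻¹' Iic (p * m + S.α * f m) := by
    ext β
    exact ⟨fun h => ⟨h.1, h.2 m hm.1⟩, fun h => ⟨h.1, fun β' hβ' => le_trans h.2 (hm.2 β' hβ')⟩⟩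
  have hK : IsCompact {β | S.IsTarget f p β} := by
    rw [heq]
    exact isCompact_Icc.of_isClosed_subset hcl inter_subset_left
  obtain ⟨m₁, h₁⟩ := hK.exists_isLeast ⟨m, hm⟩
  obtain ⟨m₂, h₂⟩ := hK.exists_isGreatest ⟨m, hm⟩
  exact ⟨m₁, m₂, h₁, h₂⟩

/-- The thresholds in state `x` are the minimizers of `p(x) β + α G_x(β)`. -/
theorem isThreshold_iff (hηc : S.ηc = 1) (hηd : S.ηd = 1) {x : S.State}
    (hcvx : ConvexOn ℝ (Icc 0 S.Bmax) (S.G x)) (hcont : ContinuousOn (S.G x) (Icc 0 S.Bmax))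
    (β : ℝ) : S.IsThreshold x β ↔ S.IsTarget (S.G x) (S.price x) β := by
  have hIs : S.IsThreshold x β ↔
      β ∈ Icc (S.endOne x (S.price x)) (S.endTwo x (S.price x)) := by
    simp only [IsThreshold, chargingThresholds, dischargingThresholds, hηc, hηd, inv_one, one_mul,
      and_self]
  rw [hIs]
  set p := S.price x
  have hα := S.α_mem.1
  have hzero : p + S.α * (-p / S.α) = 0 := by field_simp; ring
  obtain ⟨m₁, m₂, h₁, h₂⟩ := exists_isLeast_isGreatest_isTarget hcont p
  -- The least minimizer lies in `setOne` through the subgradient `-p / α`, and an element of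
  -- `setOne` below it would be a smaller minimizer. In particular the set is nonempty and the
  -- default value in `endOne` is never taken; `setTwo` is symmetric.
  have hone : IsLeast (S.setOne x p) m₁ := by
    refine ⟨⟨h₁.1.1, _, (isTarget_G_iff.1 h₁.1).2, hzero.ge⟩, ?_⟩
    rintro β ⟨hβ, g, hg, hge⟩
    by_contra! hlt
    exact hlt.not_ge (h₁.2 (h₁.1.of_subgradient hβ hg (mul_nonneg hge (sub_pos.2 hlt).le)))
  have htwo : IsGreatest (S.setTwo x p) m₂ := by
    refine ⟨⟨h₂.1.1, _, (isTarget_G_iff.1 h₂.1).2, hzero.le⟩, ?_⟩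
    rintro β ⟨hβ, g, hg, hle⟩
    by_contra! hlt
    exact hlt.not_ge (h₂.2 (h₂.1.of_subgradient hβ hg
      (mul_nonneg_of_nonpos_of_nonpos hle (sub_neg.2 hlt).le)))
  rw [endOne, if_pos hone.nonempty, hone.csInf_eq, endTwo, if_pos htwo.nonempty, htwo.csSup_eq]
  refine ⟨fun hβ => ?_, fun hβ => ⟨h₁.2 hβ, h₂.2 hβ⟩⟩
  -- Convexity fills the gap: every point between the extreme minimizers is a minimizer.
  have hφ : ConvexOn ℝ (Icc 0 S.Bmax) fun a => p * a + S.α * S.G x a :=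
    ((LinearMap.mulLeft ℝ p).convexOn (convex_Icc _ _)).add (hcvx.smul hα.le)
  have hmax := hφ.le_max_of_mem_Icc h₁.1.1 h₂.1.1 hβ
  rw [max_eq_left (h₂.1.2 m₁ h₁.1.1)] at hmax
  exact ⟨⟨h₁.1.1.1.trans hβ.1, hβ.2.trans h₂.1.1.2⟩, fun β' hβ' => hmax.trans (h₁.1.2 β' hβ')⟩

theorem isOptimal_thresholdPath (hηc : S.ηc = 1) (hηd : S.ηd = 1) (hconv : S.ConvexControl)
    {f : ℝ →ᵇ ℝ} (hcvx : ConvexOn ℝ (Icc 0 S.Bmax) f)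
    (hf : ∀ x, ∀ b ∈ Icc 0 S.Bmax, f b = ∫ y, S.stepValue f y b ∂S.κ x)
    {β : S.State → ℝ} (hβ : Measurable β) (htarget : ∀ x, S.IsTarget f (S.price x) (β x))
    (x : S.State) {b : ℝ} (hb : b ∈ Icc 0 S.Bmax) :
    S.IsOptimal x b (S.thresholdPath β β b) ∧
      S.cost x (S.thresholdPath β β b) = S.stepValue f x b := by
  have hadm := hconv.admissible_thresholdPath hβ hb
  have hcost := hadm.cost_eq_stepValue hb hconv hf (fun n ω =>
    (htarget (ω n)).stepValue_eq hηc hηd hcvx f.continuous.continuousOn (hadm.mem_Icc hb n ω)) x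
  refine ⟨⟨hadm, fun B' hB' => ?_⟩, hcost⟩
  rw [hcost]
  exact hB'.stepValue_le_cost hb hηc hηd hconv hcvx hf x

/-- The infimum is attained by the policy that follows `target`, which is measurable because it is
monotone in the price. -/
theorem J_eq_stepValue (hηc : S.ηc = 1) (hηd : S.ηd = 1) (hconv : S.ConvexControl)
    {f : ℝ →ᵇ ℝ} (hcvx : ConvexOn ℝ (Icc 0 S.Bmax) f)
    (hf : ∀ x, ∀ b ∈ Icc 0 S.Bmax, f b = ∫ y, S.stepValue f y b ∂S.κ x)
    (x : S.State) {b : ℝ} (hb : b ∈ Icc 0 S.Bmax) : S.J x b = S.stepValue f x b := by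
  have hcont := f.continuous.continuousOn (s := Icc 0 S.Bmax)
  have h := isOptimal_thresholdPath hηc hηd hconv hcvx hf (β := fun x => S.target f (S.price x))
    ((antitone_target hcont).measurable.comp measurable_price)
    (fun x => isTarget_target hcont _) x hb
  refine IsLeast.csInf_eq ⟨⟨_, h.1.1, h.2.symm⟩, ?_⟩
  rintro _ ⟨B, hB, rfl⟩
  exact hB.stepValue_le_cost hb hηc hηd hconv hcvx hf x

/-- When prices and demands are i.i.d. across time, `G_x` is one convex continuous function on
`[0, Bmax]`, the same for all states, and it solves the dynamic programming equation. -/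
theorem IIDDemandPrice.exists_G_eqOn [Nonempty S.State] (hηc : S.ηc = 1) (hηd : S.ηd = 1)
    (hiid : S.IIDDemandPrice) (hconv : S.ConvexControl) :
    ∃ f : ℝ →ᵇ ℝ, ConvexOn ℝ (Icc 0 S.Bmax) f ∧
      (∀ x, ∀ b ∈ Icc 0 S.Bmax, f b = ∫ y, S.stepValue f y b ∂S.κ x) ∧
      ∀ x, EqOn f (S.G x) (Icc 0 S.Bmax) := by
  obtain ⟨x₀⟩ := ‹Nonempty S.State›
  obtain ⟨f, hcvx, hfix⟩ := exists_fixedPoint hηc hηd hconv (S.κ x₀)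
  -- The fixed point built from the transition law at the single state `x₀` serves every state.
  have hf : ∀ x, ∀ b ∈ Icc 0 S.Bmax, f b = ∫ y, S.stepValue f y b ∂S.κ x := fun x b hb =>
    (hfix b hb).trans (hiid.integral_stepValue_eq f.continuous hb x₀ x)
  refine ⟨f, hcvx, hf, fun x b hb => ?_⟩
  simp only [G, J_eq_stepValue hηc hηd hconv hcvx hf _ hb]
  exact hf x b hb

end StorageModel

end

theorem proposition3 {M : Type*} [MeasurableSpace M] [Nonempty M] (S : StorageModel M)
    (hηc : S.ηc = 1) (hηd : S.ηd = 1) (hiid : S.IIDDemandPrice) (hconv : S.ConvexControl) :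
    (∀ x : S.State, ∃ β : ℝ, S.IsThreshold x β) ∧
    (∀ x y : S.State, S.price x = S.price y →
      ∀ β : ℝ, S.IsThreshold x β ↔ S.IsThreshold y β) ∧
    (∀ β : S.P → ℝ, (∀ x : S.State, S.IsThreshold x (β x.2.1)) →
      Antitone β ∧
      ∀ x : S.State, ∀ b ∈ Icc 0 S.Bmax,
        S.IsOptimal x b (S.thresholdPath (fun y => β y.2.1) (fun y => β y.2.1) b)) := by
  obtain ⟨d₀, hd₀⟩ := S.D_nonempty
  obtain ⟨p₀, hp₀⟩ := S.P_nonempty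
  obtain ⟨m₀⟩ := ‹Nonempty M›
  have : Nonempty S.State := ⟨(⟨d₀, hd₀⟩, ⟨p₀, hp₀⟩, m₀)⟩
  obtain ⟨f, hcvx, hf, hG⟩ := hiid.exists_G_eqOn hηc hηd hconv
  have hcont : ContinuousOn f (Icc 0 S.Bmax) := f.continuous.continuousOn
  have hiff (x : S.State) (β : ℝ) : S.IsThreshold x β ↔ S.IsTarget f (S.price x) β := by
    rw [StorageModel.isThreshold_iff hηc hηd (hcvx.congr (hG x)) (hcont.congr (hG x).symm)]
    exact ⟨fun h => h.congr (hG x).symm, fun h => h.congr (hG x)⟩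
  simp only [hiff]
  refine ⟨fun x => StorageModel.exists_isTarget hcont _, fun x y hxy β => by rw [hxy],
    fun β hβ => ?_⟩
  -- Any two prices can be compared because each occurs in a state, with `d₀` and `m₀` as the other
  -- components.
  have hanti : Antitone β := by
    intro p q hpq
    rcases hpq.eq_or_lt with rfl | hlt
    · exact le_rfl
    · exact (hβ (⟨d₀, hd₀⟩, p, m₀)).le_of_lt (hβ (⟨d₀, hd₀⟩, q, m₀)) hlt
  -- The function `β` is arbitrary; its measurability, needed for the policy to be admissible, comes
  -- from `hanti`.
  exact ⟨hanti, fun x b hb => (StorageModel.isOptimal_thresholdPath hηc hηd hconv hcvx hf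
    (hanti.measurable.comp (measurable_fst.comp measurable_snd)) hβ x hb).1⟩
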